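/- Let $G$ be a finite group. The prime-order element graph $\Gamma(G)$ is the simple graph with vertex set $G$ in which two distinct elements $x,y$ are adjacent if and only if the order of $xy$ is a prime number. A graph is chordal if it contains no induced cycle of length at least $4$. Then $\Gamma(G)$ is chordal if and only if $G$ is isomorphic to one of the following groups: the symmetric group $S_3$; the cyclic group $\mathbb{Z}_3$; the cyclic group $\mathbb{Z}_{2^n}$ for some $n\ge 0$; the generalized quaternion group $Q_{2^n}$ of order $2^n$ for some $n\ge 3$; the elementary abelian group $\mathbb{Z}_2^n$ for some $n\ge 0$. -/

import Mathlib

/-- The prime-order element graph of a group `G`: the vertices are the elements of `G`, and two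
distinct elements `x`, `y` are adjacent exactly when the order of `x * y` is prime. -/
def primeOrderGraph (G : Type*) [Group G] : SimpleGraph G where
  Adj x y := x ≠ y ∧ (orderOf (x * y)).Prime
  symm := ⟨fun x y h => ⟨h.1.symm, by
    have s : SemiconjBy x (y * x) (x * y) := by simp [SemiconjBy, mul_assoc]
    rw [s.orderOf_eq]
    exact h.2⟩⟩
  loopless := ⟨fun _ h => h.1 rfl⟩

/-- A graph is chordal if it has no induced cycle of length at least four. -/
def IsChordal {V : Type*} (Γ : SimpleGraph V) : Prop :=
  ∀ n : ℕ, 4 ≤ n → IsEmpty (SimpleGraph.cycleGraph n ↪g Γ)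

/-!
Write `𝒫` for the set of elements of prime order of a finite group `G`, so that `x` and `y` are
adjacent when `x ≠ y` and `x * y ∈ 𝒫`.

The groups of the list have chordal graphs for one of two reasons. If `𝒫` has at most one element,
every vertex has at most one neighbour (`isChordal_of_prime_orderOf_unique`); this is the case of
cyclic `2`-groups and of generalized quaternion groups. If `𝒫` contains all nontrivial elements,
only the edges `{x, x⁻¹}` are missing from the complete graph, and when at most two elements differ
from their inverses this leaves no long induced cycle
(`isChordal_of_prime_orderOf_of_ne_one`); this is the case of `S₃`, `ℤ/3` and `(ℤ/2)ⁿ`.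

Conversely, let the graph be chordal. The main source of induced `4`-cycles is
`not_isChordal_of_mul_of_mul_inv`: if `g * h` and `g * h⁻¹` lie in `𝒫`, and neither `g` nor `h`
squares to `1`, then `g, h, g⁻¹, h⁻¹` is one. Cycles of this kind and a few others exclude prime
orders at least five, elements of order six or nine, and subgroups of order nine; so `G` has order
`2ⁿ` or `3 * 2ⁿ`.

A `2`-group with chordal graph has exponent at most two or a single involution
(`forall_mul_self_eq_one_or_involution_unique`). In the first case it is elementary abelian, in
the second case it is cyclic or generalized quaternion by a classical theorem
(`isCyclic_or_quaternionGroup`), proved here by looking at the action of the group on a maximal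
normal cyclic subgroup.

If `3` divides the order of `G`, a Sylow `2`-subgroup `S` has index three. It contains at most one
involution: otherwise it has exponent two, every nontrivial element of `G` has prime order, and
`eq_of_commute_of_orderOf_eq_two` gives a contradiction. As `G` has no elements of order six, the
normal core of `S` contains no involution, so `G` acts faithfully on the three cosets of `S`
(`mulEquiv_of_index_eq_three`) and is `S₃` or `ℤ/3`.
-/

/-! ### Induced cycles in the prime-order element graph -/

theorem IsChordal.of_embedding {V W : Type*} {Γ : SimpleGraph V} {Δ : SimpleGraph W}
    (h : IsChordal Δ) (f : Γ ↪g Δ) : IsChordal Γ :=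
  fun n hn => ⟨fun g => (h n hn).false (g.trans f)⟩

theorem IsChordal.of_injective_hom {G H : Type*} [Group G] [Group H]
    (h : IsChordal (primeOrderGraph H)) (f : G →* H) (hf : Function.Injective f) :
    IsChordal (primeOrderGraph G) :=
  h.of_embedding
    { toFun := f
      inj' := hf
      map_rel_iff' := by
        intro a b
        change (f a ≠ f b ∧ (orderOf (f a * f b)).Prime) ↔ (a ≠ b ∧ (orderOf (a * b)).Prime)
        rw [hf.ne_iff, ← map_mul, orderOf_injective f hf] }

section Cycles

variable {G : Type*} [Group G]

theorem orderOf_mul_comm (x y : G) : orderOf (x * y) = orderOf (y * x) := by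
  have s : SemiconjBy y (x * y) (y * x) := by simp [SemiconjBy, mul_assoc]
  exact s.orderOf_eq

/-- An induced `4`-cycle `a, b, c, d`. Neighbours are automatically distinct: if `a = b`, say, then
`b * c = a * c` would have to be both prime and not prime in order. -/
theorem not_isChordal_of_square {a b c d : G} (hac : a ≠ c) (hbd : b ≠ d)
    (hab : (orderOf (a * b)).Prime) (hbc : (orderOf (b * c)).Prime)
    (hcd : (orderOf (c * d)).Prime) (hda : (orderOf (d * a)).Prime)
    (nac : ¬ (orderOf (a * c)).Prime) (nbd : ¬ (orderOf (b * d)).Prime) :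
    ¬ IsChordal (primeOrderGraph G) := by
  intro h
  have nab : a ≠ b := by rintro rfl; exact nac hbc
  have nbc : b ≠ c := by rintro rfl; exact nac hab
  have ncd : c ≠ d := by rintro rfl; exact nbd hbc
  have nda : d ≠ a := by rintro rfl; exact nbd (by rwa [orderOf_mul_comm])
  have hba := orderOf_mul_comm a b ▸ hab
  have hcb := orderOf_mul_comm b c ▸ hbc
  have hdc := orderOf_mul_comm c d ▸ hcd
  have had := orderOf_mul_comm d a ▸ hda
  have nca := orderOf_mul_comm a c ▸ nac
  have ndb := orderOf_mul_comm b d ▸ nbd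
  refine (h 4 le_rfl).false
    { toFun := ![a, b, c, d]
      inj' := ?_
      map_rel_iff' := ?_ }
  · intro i j hij
    fin_cases i <;> fin_cases j <;> simp_all
  · intro i j
    change ((![a, b, c, d] i ≠ ![a, b, c, d] j) ∧
      (orderOf (![a, b, c, d] i * ![a, b, c, d] j)).Prime) ↔ _
    rw [SimpleGraph.cycleGraph_adj']
    fin_cases i <;> fin_cases j <;>
      simp [hab, hbc, hcd, hda, hba, hcb, hdc, had, nac, nca, nbd, ndb, nab, nbc, ncd, nda,
        nab.symm, nbc.symm, ncd.symm, nda.symm] <;> decide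

/-- The induced `4`-cycle `g, h, g⁻¹, h⁻¹`: its edges carry the products `g * h`, `h * g⁻¹` and
conjugates of their inverses. -/
theorem not_isChordal_of_mul_of_mul_inv {g h : G} (hg : g * g ≠ 1) (hh : h * h ≠ 1)
    (h₁ : (orderOf (g * h)).Prime) (h₂ : (orderOf (g * h⁻¹)).Prime) :
    ¬ IsChordal (primeOrderGraph G) := by
  refine not_isChordal_of_square (a := g) (b := h) (c := g⁻¹) (d := h⁻¹) ?_ ?_ h₁ ?_ ?_ ?_ ?_ ?_
  · exact fun e => hg (mul_eq_one_iff_eq_inv.2 e)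
  · exact fun e => hh (mul_eq_one_iff_eq_inv.2 e)
  · rwa [← orderOf_inv, mul_inv_rev, inv_inv]
  · rwa [← mul_inv_rev, orderOf_inv, orderOf_mul_comm]
  · rwa [orderOf_mul_comm]
  · simp [Nat.not_prime_one]
  · simp [Nat.not_prime_one]

theorem orderOf_eq_two_of_mul_self {x : G} (h : x * x = 1) (h₁ : x ≠ 1) : orderOf x = 2 :=
  orderOf_eq_prime (by rwa [sq]) h₁

theorem mul_self_eq_one_of_orderOf {x : G} (h : orderOf x = 2) : x * x = 1 := by
  rw [← sq, ← h, pow_orderOf_eq_one]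

theorem prime_orderOf_of_mul_self {x : G} (h : x * x = 1) (h₁ : x ≠ 1) : (orderOf x).Prime := by
  rw [orderOf_eq_two_of_mul_self h h₁]
  exact Nat.prime_two

/-! ### The groups of the list have chordal graphs -/

theorem cycleGraph_not_adj_add_two {n i j : ℕ} (hn : 4 ≤ n) (hj : j < n) (hij : j = i + 2) :
    ¬ (SimpleGraph.cycleGraph n).Adj ⟨i, by omega⟩ ⟨j, hj⟩ := by
  rw [SimpleGraph.cycleGraph_adj', Fin.sub_def, Fin.sub_def]
  subst hij
  have e₁ : (n - (i + 2) + i) % n = n - 2 := by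
    rw [show n - (i + 2) + i = n - 2 by omega, Nat.mod_eq_of_lt (by omega)]
  have e₂ : (n - i + (i + 2)) % n = 2 := by
    rw [show n - i + (i + 2) = 2 + n by omega, Nat.add_mod_right, Nat.mod_eq_of_lt (by omega)]
  simp only [e₁, e₂]
  omega

/-- With at most one element `z` of prime order, `x` has at most the neighbour `x⁻¹ * z`, so there
are no cycles at all. -/
theorem isChordal_of_prime_orderOf_unique
    (h : ∀ x y : G, (orderOf x).Prime → (orderOf y).Prime → x = y) :
    IsChordal (primeOrderGraph G) := by
  refine fun n hn => ⟨fun f => ?_⟩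
  have h₁ : (SimpleGraph.cycleGraph n).Adj ⟨1, by omega⟩ ⟨0, by omega⟩ := by
    rw [SimpleGraph.cycleGraph_adj', Fin.sub_def, Fin.sub_def]
    left
    simp [Nat.mod_eq_of_lt (show 1 < n by omega)]
  have h₂ : (SimpleGraph.cycleGraph n).Adj ⟨1, by omega⟩ ⟨2, by omega⟩ := by
    rw [SimpleGraph.cycleGraph_adj', Fin.sub_def, Fin.sub_def]
    right
    simp only
    rw [show n - 1 + 2 = 1 + n by omega, Nat.add_mod_right, Nat.mod_eq_of_lt (by omega)]
  have e := h _ _ (f.map_rel_iff.2 h₁).2 (f.map_rel_iff.2 h₂).2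
  have := f.injective (mul_left_cancel e)
  simp at this

/-- If all nontrivial elements have prime order, the graph is complete up to the missing edges
`{x, x⁻¹}`. A long induced cycle would have two disjoint missing edges, so at least three
elements which are not their own inverses. -/
theorem isChordal_of_prime_orderOf_of_ne_one (h : ∀ x : G, x ≠ 1 → (orderOf x).Prime)
    (h' : ∀ x y z : G, x * x ≠ 1 → y * y ≠ 1 → z * z ≠ 1 → x = y ∨ x = z ∨ y = z) :
    IsChordal (primeOrderGraph G) := by
  refine fun n hn => ⟨fun f => ?_⟩
  have key : ∀ i j : Fin n, i ≠ j → ¬ (SimpleGraph.cycleGraph n).Adj i j →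
      f i * f i ≠ 1 ∧ f j * f j ≠ 1 := by
    intro i j hij hn
    have hne : f i ≠ f j := fun e => hij (f.injective e)
    have h1 : f i * f j = 1 := by
      by_contra h1
      exact hn (f.map_rel_iff.1 ⟨hne, h _ h1⟩)
    constructor
    · intro e; exact hne (mul_left_cancel (e.trans h1.symm))
    · intro e; exact hne (mul_right_cancel (h1.trans e.symm))
  obtain ⟨a, b⟩ := key ⟨0, by omega⟩ ⟨2, by omega⟩ (by simp)
    (cycleGraph_not_adj_add_two hn _ rfl)
  obtain ⟨c, -⟩ := key ⟨1, by omega⟩ ⟨3, by omega⟩ (by simp)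
    (cycleGraph_not_adj_add_two hn _ rfl)
  rcases h' _ _ _ a b c with e | e | e <;> simpa using f.injective e

end Cycles

theorem isChordal_perm_fin_three : IsChordal (primeOrderGraph (Equiv.Perm (Fin 3))) := by
  apply isChordal_of_prime_orderOf_of_ne_one
  · intro x hx
    have : x ^ 2 = 1 ∨ x ^ 3 = 1 := by revert x; decide
    rcases this with e | e
    · rw [orderOf_eq_prime e hx]; exact Nat.prime_two
    · rw [orderOf_eq_prime e hx]; exact Nat.prime_three
  · decide

theorem isChordal_zmod_three : IsChordal (primeOrderGraph (Multiplicative (ZMod 3))) := by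
  apply isChordal_of_prime_orderOf_of_ne_one
  · intro x hx
    have : x ^ 3 = 1 := by revert x; decide
    rw [orderOf_eq_prime this hx]; exact Nat.prime_three
  · exact (by decide : ∀ x y z : ZMod 3, ¬ x + x = 0 → ¬ y + y = 0 → ¬ z + z = 0 →
      x = y ∨ x = z ∨ y = z)

theorem isChordal_pi_zmod_two (n : ℕ) :
    IsChordal (primeOrderGraph (Multiplicative (Fin n → ZMod 2))) := by
  have h : ∀ x : Multiplicative (Fin n → ZMod 2), x * x = 1 := by
    intro x
    apply Multiplicative.toAdd.injective
    funext i
    exact CharTwo.add_self_eq_zero (x.toAdd i)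
  exact isChordal_of_prime_orderOf_of_ne_one (fun x hx => prime_orderOf_of_mul_self (h x) hx)
    fun x _ _ hx => absurd (h x) hx

theorem IsCyclic.eq_of_orderOf_eq_two {G : Type*} [Group G] [Finite G] [IsCyclic G] {x y : G}
    (hx : orderOf x = 2) (hy : orderOf y = 2) : x = y := by
  classical
  have := Fintype.ofFinite G
  have h := IsCyclic.card_orderOf_eq_totient (α := G) (d := 2) (hx ▸ orderOf_dvd_card)
  rw [Nat.totient_two] at h
  exact Finset.card_le_one.1 h.le _ (by simp [hx]) _ (by simp [hy])

/-- In a `2`-group with at most one involution, the involution is the only element of prime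
order. -/
theorem isChordal_of_isPGroup_two {G : Type*} [Group G] [Finite G] (hG : IsPGroup 2 G)
    (h : ∀ x y : G, orderOf x = 2 → orderOf y = 2 → x = y) : IsChordal (primeOrderGraph G) := by
  have key : ∀ x : G, (orderOf x).Prime → orderOf x = 2 := by
    intro x hx
    obtain ⟨k, hk⟩ := isPGroup_iff_orderOf_dvd_pow.1 hG x
    exact (Nat.prime_dvd_prime_iff_eq hx Nat.prime_two).1 (hx.dvd_of_dvd_pow hk)
  exact isChordal_of_prime_orderOf_unique fun x y hx hy => h x y (key x hx) (key y hy)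

theorem isChordal_zmod_two_pow (n : ℕ) :
    IsChordal (primeOrderGraph (Multiplicative (ZMod (2 ^ n)))) := by
  apply isChordal_of_isPGroup_two
  · exact IsPGroup.of_card (n := n) (by simp)
  · intro x y hx hy
    exact IsCyclic.eq_of_orderOf_eq_two hx hy

theorem isChordal_quaternionGroup (n : ℕ) :
    IsChordal (primeOrderGraph (QuaternionGroup (2 ^ n))) := by
  apply isChordal_of_isPGroup_two
  · refine IsPGroup.of_card (n := n + 2) ?_
    rw [Nat.card_eq_fintype_card, QuaternionGroup.card]
    ring
  · -- The elements `xa i` have order four, and the `a i` form a cyclic group.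
    intro x y hx hy
    have key : ∀ x : QuaternionGroup (2 ^ n), orderOf x = 2 →
        x ∈ Subgroup.zpowers (QuaternionGroup.a 1 : QuaternionGroup (2 ^ n)) := by
      rintro (i | i) hi
      · have h := Subgroup.npow_mem_zpowers (QuaternionGroup.a 1 : QuaternionGroup (2 ^ n)) i.val
        rwa [QuaternionGroup.a_one_pow, ZMod.natCast_zmod_val] at h
      · simp at hi
    have := IsCyclic.eq_of_orderOf_eq_two (x := (⟨x, key x hx⟩ : Subgroup.zpowers _))
      (y := ⟨y, key y hy⟩) (by simpa using hx) (by simpa using hy)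
    simpa using this

/-! ### Finite `2`-groups with at most one involution -/

section TwoGroups

variable {P : Type*} [Group P]

/-- A nontrivial normal subgroup of a `p`-group contains a central element of order `p`: by the
fixed point congruence, conjugation fixes a nontrivial element of the subgroup. -/
theorem IsPGroup.exists_mem_center_orderOf_eq [Finite P] {p : ℕ} [Fact p.Prime]
    (hP : IsPGroup p P) (N : Subgroup P) [N.Normal] (hN : N ≠ ⊥) :
    ∃ x ∈ N, x ∈ Subgroup.center P ∧ orderOf x = p := by
  have hC : IsPGroup p (ConjAct P) := hP.of_equiv ConjAct.toConjAct
  have hdvd : p ∣ Nat.card N := by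
    rcases (hP.to_subgroup N).card_eq_or_dvd with h | h
    · exact absurd (Subgroup.card_eq_one.1 h) hN
    · exact h
  have h1 : (1 : N) ∈ MulAction.fixedPoints (ConjAct P) N := fun g => smul_one g
  obtain ⟨b, hb, hb1⟩ := hC.exists_fixed_point_of_prime_dvd_card_of_fixed_point N hdvd h1
  have hbc : (b : P) ∈ Subgroup.center P := by
    rw [Subgroup.mem_center_iff]
    intro g
    have h := congrArg Subtype.val (hb (ConjAct.toConjAct g))
    rw [ConjAct.Subgroup.val_conj_smul, ConjAct.toConjAct_smul] at h
    exact mul_inv_eq_iff_eq_mul.1 h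
  have hb1' : (b : P) ≠ 1 := fun e => hb1 (Subtype.ext e.symm)
  have hd : p ∣ orderOf (b : P) := hP.dvd_orderOf hb1'
  exact ⟨(b : P) ^ (orderOf (b : P) / p), N.pow_mem b.2 _,
    (Subgroup.center P).pow_mem hbc _, orderOf_pow_orderOf_div (orderOf_pos _).ne' hd⟩

theorem conj_zpow_of_conj {g a : P} {i : ℤ} (h : g * a * g⁻¹ = a ^ i) (j : ℤ) :
    g * a ^ j * g⁻¹ = a ^ (i * j) := by
  rw [← conj_zpow, h, zpow_mul]

theorem exists_conj_eq_zpow {a : P} (ha : (Subgroup.zpowers a).Normal) (g : P) :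
    ∃ i : ℤ, g * a * g⁻¹ = a ^ i := by
  obtain ⟨i, hi⟩ := ha.conj_mem a (Subgroup.mem_zpowers a) g
  exact ⟨i, hi.symm⟩

/-- The elements acting on `⟨a⟩` by conjugation as a power map `x ↦ x ^ i` with `i ≡ 1` modulo
`4`; the finiteness of the group makes this set closed under inverses. -/
def oneModFour [Finite P] (a : P) : Subgroup P :=
  have hmul : ∀ g h : P, (∃ k : ℤ, g * a * g⁻¹ = a ^ (4 * k + 1)) →
      (∃ k : ℤ, h * a * h⁻¹ = a ^ (4 * k + 1)) →
      ∃ k : ℤ, (g * h) * a * (g * h)⁻¹ = a ^ (4 * k + 1) := by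
    rintro g h ⟨k, hk⟩ ⟨l, hl⟩
    refine ⟨4 * k * l + k + l, ?_⟩
    rw [show g * h * a * (g * h)⁻¹ = g * (h * a * h⁻¹) * g⁻¹ by group, hl,
      conj_zpow_of_conj hk]
    congr 1
    ring
  have hone : ∃ k : ℤ, (1 : P) * a * 1⁻¹ = a ^ (4 * k + 1) := ⟨0, by simp⟩
  { carrier := {g | ∃ k : ℤ, g * a * g⁻¹ = a ^ (4 * k + 1)}
    mul_mem' := fun {g h} hg hh => hmul g h hg hh
    one_mem' := hone
    inv_mem' := by
      intro g hg
      obtain ⟨n, hn⟩ := mem_powers_iff_mem_zpowers.2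
        ((Subgroup.zpowers g).inv_mem (Subgroup.mem_zpowers g))
      have key : ∀ n : ℕ, ∃ k : ℤ, g ^ n * a * (g ^ n)⁻¹ = a ^ (4 * k + 1) := by
        intro n
        induction n with
        | zero => simpa using hone
        | succ n ih => rw [pow_succ]; exact hmul _ _ ih hg
      have := key n
      simp only at hn
      rwa [hn] at this }

theorem mem_oneModFour [Finite P] {a g : P} :
    g ∈ oneModFour a ↔ ∃ k : ℤ, g * a * g⁻¹ = a ^ (4 * k + 1) :=
  Iff.rfl

theorem zpowers_le_oneModFour [Finite P] (a : P) : Subgroup.zpowers a ≤ oneModFour a := by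
  rw [Subgroup.zpowers_le]
  exact ⟨0, by simp⟩

theorem oneModFour_normal [Finite P] {a : P} (ha : (Subgroup.zpowers a).Normal) :
    (oneModFour a).Normal := by
  constructor
  rintro g ⟨k, hk⟩ h
  obtain ⟨j, hj⟩ := exists_conj_eq_zpow ha h⁻¹
  refine ⟨k, ?_⟩
  rw [show h * g * h⁻¹ * a * (h * g * h⁻¹)⁻¹ = h * (g * (h⁻¹ * a * h⁻¹⁻¹) * g⁻¹) * h⁻¹ by group,
    hj, conj_zpow_of_conj hk, mul_comm, zpow_mul, ← hj, ← conj_zpow]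
  group

/-- If `g ^ 2` is an even power of `a` and `g` acts on `⟨a⟩` as a power map with exponent
`4 * i + 1`, then some `a ^ j * g` squares to `1`: as `2 * i + 1` is invertible modulo the order
of `a`, the equation `(4 * i + 2) * j + 2 * l = 0` has a solution `j`. -/
theorem exists_zpow_mul_sq_eq_one {a g : P} {m : ℕ} (hm : orderOf a = 2 ^ m) {i l : ℤ}
    (hg : g * a * g⁻¹ = a ^ (4 * i + 1)) (hl : g * g = a ^ (2 * l)) :
    ∃ j : ℤ, (a ^ j * g) * (a ^ j * g) = 1 := by
  have hc : IsCoprime ((2 * i + 1 : ℤ)) (2 ^ m) := by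
    apply IsCoprime.pow_right
    exact ⟨1, -i, by ring⟩
  obtain ⟨u, v, huv⟩ := hc
  refine ⟨-l * u, ?_⟩
  have e : a ^ (-l * u) * g * (a ^ (-l * u) * g) =
      a ^ (-l * u) * (g * a ^ (-l * u) * g⁻¹) * (g * g) := by group
  rw [e, conj_zpow_of_conj hg, hl, ← zpow_add, ← zpow_add, ← orderOf_dvd_iff_zpow_eq_one, hm]
  refine ⟨2 * l * v, ?_⟩
  push_cast
  linear_combination (-2 * l) * huv

/-- In a finite `2`-group with at most one involution, a maximal normal cyclic subgroup `⟨a⟩`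
consists of all elements that act on it as `1` modulo `4`. Otherwise there is `g` among these
elements, outside of `⟨a⟩`, whose image in the quotient is a central involution. If `g ^ 2` is an
even power of `a`, there is an involution outside of `⟨a⟩`; if it is an odd power, `⟨g⟩` is normal
and larger than `⟨a⟩`. -/
theorem oneModFour_eq_zpowers [Finite P] (hP : IsPGroup 2 P)
    (hu : ∀ x y : P, orderOf x = 2 → orderOf y = 2 → x = y) {a w : P}
    (ha : (Subgroup.zpowers a).Normal)
    (hmax : ∀ b : P, (Subgroup.zpowers b).Normal → orderOf b ≤ orderOf a)
    (hw : w ∈ Subgroup.zpowers a) (hw2 : orderOf w = 2) :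
    oneModFour a = Subgroup.zpowers a := by
  have : Fact (Nat.Prime 2) := ⟨Nat.prime_two⟩
  refine le_antisymm ?_ (zpowers_le_oneModFour a)
  by_contra hle
  have hn := oneModFour_normal ha
  let π := QuotientGroup.mk' (Subgroup.zpowers a)
  have hN : ((oneModFour a).map π).Normal := hn.map π (QuotientGroup.mk'_surjective _)
  have hNb : (oneModFour a).map π ≠ ⊥ := by
    intro h
    rw [Subgroup.map_eq_bot_iff, QuotientGroup.ker_mk'] at h
    exact hle h
  obtain ⟨_, ⟨g, ⟨i, hi⟩, rfl⟩, hgc, hg2⟩ :=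
    (hP.to_quotient (Subgroup.zpowers a)).exists_mem_center_orderOf_eq _ hNb
  have hga : g ∉ Subgroup.zpowers a := by
    intro h
    rw [show π g = 1 from (QuotientGroup.eq_one_iff g).2 h, orderOf_one] at hg2
    omega
  have hsq : g * g ∈ Subgroup.zpowers a := by
    have h := mul_self_eq_one_of_orderOf hg2
    rw [← map_mul] at h
    exact (QuotientGroup.eq_one_iff _).1 h
  obtain ⟨k, hk⟩ := hsq
  simp only at hk
  obtain ⟨m, hm⟩ := (IsPGroup.iff_orderOf.1 hP) a
  rcases Int.even_or_odd' k with ⟨l, rfl | rfl⟩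
  · obtain ⟨j, hj⟩ := exists_zpow_mul_sq_eq_one hm hi hk.symm
    have hmem : a ^ j * g ∈ Subgroup.zpowers a := by
      by_cases h1 : a ^ j * g = 1
      · rw [h1]; exact one_mem _
      · rwa [hu _ _ (orderOf_eq_two_of_mul_self hj h1) hw2]
    exact hga ((Subgroup.mul_mem_cancel_left _
      (Subgroup.zpow_mem _ (Subgroup.mem_zpowers a) j)).1 hmem)
  · have hag : a ∈ Subgroup.zpowers g := by
      have hc : IsCoprime ((2 * l + 1 : ℤ)) (2 ^ m) := by
        apply IsCoprime.pow_right
        exact ⟨1, -l, by ring⟩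
      obtain ⟨u, v, huv⟩ := hc
      refine ⟨2 * u, ?_⟩
      have e : (a : P) ^ (2 ^ m : ℤ) = 1 := by
        rw [← orderOf_dvd_iff_zpow_eq_one, hm]
        push_cast
        rfl
      calc g ^ (2 * u) = (g * g) ^ u := by rw [zpow_mul, zpow_two]
        _ = a ^ (u * (2 * l + 1)) := by rw [← hk, ← zpow_mul, mul_comm]
        _ = a ^ (u * (2 * l + 1) + v * 2 ^ m) := by
            rw [zpow_add, mul_comm v, zpow_mul _ (2 ^ m), e, one_zpow, mul_one]
        _ = a := by rw [huv, zpow_one]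
    have hle' : Subgroup.zpowers a ≤ Subgroup.zpowers g := by rwa [Subgroup.zpowers_le]
    have hgn : (Subgroup.zpowers g).Normal := by
      constructor
      rintro _ ⟨s, rfl⟩ h
      simp only
      rw [← conj_zpow]
      apply Subgroup.zpow_mem
      have h1 : π (h * g * h⁻¹) = π g := by
        rw [map_mul, map_mul, Subgroup.mem_center_iff.1 hgc (π h), mul_assoc, ← map_mul]
        simp
      have h2 : g⁻¹ * (h * g * h⁻¹) ∈ Subgroup.zpowers a := QuotientGroup.eq.1 h1.symm
      exact (Subgroup.mul_mem_cancel_left _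
        ((Subgroup.zpowers g).inv_mem (Subgroup.mem_zpowers g))).1 (hle' h2)
    have hlt : Subgroup.zpowers a < Subgroup.zpowers g :=
      lt_of_le_of_ne hle' fun e => hga (e ▸ Subgroup.mem_zpowers g)
    have hcard := Set.ncard_lt_ncard (SetLike.coe_ssubset_coe.2 hlt) (Set.toFinite _)
    have hgle := hmax g hgn
    rw [← Nat.card_zpowers, ← Nat.card_zpowers] at hgle
    exact absurd hgle (not_le.2 hcard)

/-- Recognition of the generalized quaternion group from its presentation: `a` and `g` correspond to
`a 1` and `xa 0`. -/
theorem exists_mulEquiv_quaternionGroup {a g : P} {q : ℕ} (hq : q ≠ 0) (ha : orderOf a = 2 * q)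
    (hg : g ∉ Subgroup.zpowers a) (hconj : g * a * g⁻¹ = a⁻¹) (hsq : g * g = a ^ q)
    (hcov : ∀ h : P, h ∈ Subgroup.zpowers a ∨ g⁻¹ * h ∈ Subgroup.zpowers a) :
    Nonempty (P ≃* QuaternionGroup q) := by
  have : NeZero q := ⟨hq⟩
  let φ : ZMod (2 * q) → P := fun i => a ^ (i.cast : ℤ)
  have hφ : ∀ k : ℤ, φ (k : ZMod (2 * q)) = a ^ k := by
    intro k
    change a ^ _ = a ^ k
    rw [zpow_eq_zpow_iff_modEq, ha, ← ZMod.intCast_eq_intCast_iff]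
    simp
  have hinj : Function.Injective φ := by
    intro i j hij
    obtain ⟨i, rfl⟩ := ZMod.intCast_surjective i
    obtain ⟨j, rfl⟩ := ZMod.intCast_surjective j
    rw [hφ, hφ, zpow_eq_zpow_iff_modEq, ha] at hij
    exact (ZMod.intCast_eq_intCast_iff _ _ _).2 hij
  have hswap : ∀ k : ℤ, a ^ k * g = g * a ^ (-k) := by
    intro k
    have h := conj_zpow_of_conj (hconj.trans (zpow_neg_one a).symm) (-k)
    rw [mul_inv_eq_iff_eq_mul] at h
    rw [h]
    simp
  let f : QuaternionGroup q → P
    | QuaternionGroup.a i => φ i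
    | QuaternionGroup.xa i => g * φ i
  have hmul : ∀ x y, f (x * y) = f x * f y := by
    rintro (i | i) (j | j) <;>
      obtain ⟨i, rfl⟩ := ZMod.intCast_surjective i <;>
      obtain ⟨j, rfl⟩ := ZMod.intCast_surjective j
    · change φ _ = φ _ * φ _
      rw [← Int.cast_add, hφ, hφ, hφ, zpow_add]
    · change g * φ _ = φ _ * (g * φ _)
      rw [← Int.cast_sub, hφ, hφ, hφ, ← mul_assoc, hswap, mul_assoc, ← zpow_add, neg_add_eq_sub]
    · change g * φ _ = g * φ _ * φ _
      rw [← Int.cast_add, hφ, hφ, hφ, zpow_add, mul_assoc]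
    · change φ _ = g * φ _ * (g * φ _)
      rw [← Int.cast_natCast, ← Int.cast_add, ← Int.cast_sub, hφ, hφ, hφ,
        show g * a ^ i * (g * a ^ j) = g * (a ^ i * g) * a ^ j by group, hswap, ← mul_assoc, hsq,
        ← zpow_natCast, ← zpow_add, ← zpow_add]
      congr 1
      ring
  have hmem : ∀ i, φ i ∈ Subgroup.zpowers a := fun i => ⟨_, rfl⟩
  refine ⟨(MulEquiv.ofBijective (MonoidHom.mk' f hmul) ⟨?_, ?_⟩).symm⟩
  · rintro (i | i) (j | j) hij
    · exact congrArg _ (hinj hij)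
    · refine absurd ?_ hg
      exact (Subgroup.mul_mem_cancel_right _ (hmem j)).1 ((show φ i = g * φ j from hij) ▸ hmem i)
    · refine absurd ?_ hg
      exact (Subgroup.mul_mem_cancel_right _ (hmem i)).1 ((show g * φ i = φ j from hij) ▸ hmem j)
    · exact congrArg _ (hinj (mul_left_cancel (show g * φ i = g * φ j from hij)))
  · intro h
    rcases hcov h with ⟨k, hk⟩ | ⟨k, hk⟩
    · exact ⟨QuaternionGroup.a k, (hφ k).trans hk⟩
    · refine ⟨QuaternionGroup.xa k, ?_⟩
      change g * φ k = h
      rw [hφ]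
      simp only at hk
      rw [hk, mul_inv_cancel_left]

/-- A finite `2`-group with at most one involution is cyclic or generalized quaternion. Let `⟨a⟩`
be a maximal normal cyclic subgroup. Elements outside of it act on it as `-1` modulo `4`, so it
has index at most two, and all elements outside have the involution of `⟨a⟩` as their square;
comparing the squares of `g` and `a * g` shows that `g` inverts `a`. -/
theorem isCyclic_or_quaternionGroup [Finite P] (hP : IsPGroup 2 P)
    (hu : ∀ x y : P, orderOf x = 2 → orderOf y = 2 → x = y) :
    IsCyclic P ∨ ∃ m : ℕ, 1 ≤ m ∧ Nonempty (P ≃* QuaternionGroup (2 ^ m)) := by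
  have : Fact (Nat.Prime 2) := ⟨Nat.prime_two⟩
  rcases subsingleton_or_nontrivial P with hs | hs
  · left; infer_instance
  have : Nonempty {a : P // (Subgroup.zpowers a).Normal} :=
    ⟨⟨1, by rw [Subgroup.zpowers_one_eq_bot]; infer_instance⟩⟩
  obtain ⟨⟨a, ha⟩, hmax'⟩ := Finite.exists_max
    (fun a : {a : P // (Subgroup.zpowers a).Normal} => orderOf a.1)
  have hmax : ∀ b : P, (Subgroup.zpowers b).Normal → orderOf b ≤ orderOf a :=
    fun b hb => hmax' ⟨b, hb⟩
  obtain ⟨m, hm⟩ := IsPGroup.iff_orderOf.1 hP a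
  have hm0 : m ≠ 0 := by
    rintro rfl
    obtain ⟨c, -, hc, hc2⟩ := hP.exists_mem_center_orderOf_eq ⊤ bot_lt_top.ne'
    have hcn : (Subgroup.zpowers c).Normal := by
      constructor
      intro n hn h
      rw [Subgroup.mem_center_iff.1 ((Subgroup.zpowers_le.2 hc) hn) h, mul_inv_cancel_right]
      exact hn
    have := hmax c hcn
    rw [hm, hc2] at this
    omega
  obtain ⟨r, rfl⟩ := Nat.exists_eq_succ_of_ne_zero hm0
  have hw2 : orderOf (a ^ 2 ^ r) = 2 := by
    rw [orderOf_pow_of_dvd (by positivity) (by rw [hm]; exact pow_dvd_pow 2 (by omega)), hm,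
      Nat.succ_eq_add_one, pow_succ, Nat.mul_div_cancel_left _ (by positivity)]
  have hwA : a ^ 2 ^ r ∈ Subgroup.zpowers a := Subgroup.npow_mem_zpowers a _
  have hD := oneModFour_eq_zpowers hP hu ha hmax hwA hw2
  by_cases htop : ∀ g : P, g ∈ Subgroup.zpowers a
  · exact Or.inl ⟨a, htop⟩
  push Not at htop
  obtain ⟨g, hg⟩ := htop
  have hout : ∀ h : P, h ∉ Subgroup.zpowers a → ∃ t : ℤ, h * a * h⁻¹ = a ^ (4 * t + 3) := by
    intro h hh
    obtain ⟨i, hi⟩ := exists_conj_eq_zpow ha h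
    obtain ⟨j, hj⟩ := exists_conj_eq_zpow ha h⁻¹
    have h1 : a ^ (j * i - 1) = 1 := by
      rw [zpow_sub_one, ← conj_zpow_of_conj hj, ← hi]
      group
    rw [← orderOf_dvd_iff_zpow_eq_one, hm] at h1
    have h2 : (2 : ℤ) ∣ j * i - 1 := by
      refine dvd_trans ?_ h1
      exact_mod_cast dvd_pow_self 2 hm0
    have h3 : ¬ (2 : ℤ) ∣ i := fun h3 => by
      have := h3.mul_left j
      omega
    rcases (by omega : i % 4 = 1 ∨ i % 4 = 3) with h4 | h4
    · refine absurd ?_ hh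
      rw [← hD]
      exact ⟨i / 4, by rw [hi]; congr 1; omega⟩
    · exact ⟨i / 4, by rw [hi]; congr 1; omega⟩
  have hmulA : ∀ x y : P, x ∉ Subgroup.zpowers a → y ∉ Subgroup.zpowers a →
      x * y ∈ Subgroup.zpowers a := by
    intro x y hx hy
    obtain ⟨s, hs⟩ := hout x hx
    obtain ⟨t, ht⟩ := hout y hy
    rw [← hD]
    refine ⟨4 * s * t + 3 * s + 3 * t + 2, ?_⟩
    rw [show x * y * a * (x * y)⁻¹ = x * (y * a * y⁻¹) * x⁻¹ by group, ht, conj_zpow_of_conj hs]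
    congr 1
    ring
  have hsq : ∀ x : P, x ∉ Subgroup.zpowers a → x * x = a ^ 2 ^ r := by
    intro x hx
    obtain ⟨t, ht⟩ := hout x hx
    obtain ⟨k, hk⟩ := hmulA x x hx hx
    simp only at hk
    have hne : x * x ≠ 1 := by
      intro h1
      have hx1 : x ≠ 1 := by rintro rfl; exact hx (one_mem _)
      rw [hu _ _ (orderOf_eq_two_of_mul_self h1 hx1) hw2] at hx
      exact hx hwA
    refine hu _ _ (orderOf_eq_two_of_mul_self ?_ hne) hw2
    -- `x` commutes with `x * x = a ^ k`, so `a ^ ((4 * t + 2) * k) = 1`, hence `a ^ (2 * k) = 1`.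
    have h1 : a ^ (2 * (2 * t + 1) * k) = 1 := by
      have h := conj_zpow_of_conj ht k
      rw [hk, show x * (x * x) * x⁻¹ = x * x by group, ← hk] at h
      rw [show 2 * (2 * t + 1) * k = (4 * t + 3) * k - k by ring, zpow_sub, ← h, mul_inv_cancel]
    rw [← hk, ← zpow_add, ← two_mul, ← orderOf_dvd_iff_zpow_eq_one, hm]
    rw [← orderOf_dvd_iff_zpow_eq_one, hm] at h1
    have hc : IsCoprime (((2 ^ r.succ : ℕ) : ℤ)) (2 * t + 1) := by
      push_cast
      apply IsCoprime.pow_left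
      exact ⟨-t, 1, by ring⟩
    apply hc.dvd_of_dvd_mul_left
    convert! h1 using 1
    ring
  have hag : a * g ∉ Subgroup.zpowers a := fun h =>
    hg ((Subgroup.mul_mem_cancel_left _ (Subgroup.mem_zpowers a)).1 h)
  have hconj : g * a * g⁻¹ = a⁻¹ := by
    have h := (hsq _ hag).trans (hsq _ hg).symm
    have h2 : a * (g * a * g⁻¹) * (g * g) = g * g :=
      Eq.trans (by group) h
    exact (inv_eq_of_mul_eq_one_right (mul_eq_right.1 h2)).symm
  -- If `a` is itself an involution, `g` centralises it, although it acts as `-1` modulo `4`.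
  have hr : r ≠ 0 := by
    rintro rfl
    apply hg
    rw [← hD]
    refine ⟨0, ?_⟩
    rw [hconj, mul_zero, zero_add, zpow_one, inv_eq_iff_mul_eq_one]
    exact mul_self_eq_one_of_orderOf (by simpa using hm)
  refine Or.inr ⟨r, Nat.one_le_iff_ne_zero.2 hr, ?_⟩
  refine exists_mulEquiv_quaternionGroup (by positivity) (hm.trans (by rw [pow_succ, mul_comm]))
    hg hconj (hsq g hg) ?_
  intro h
  by_cases hh : h ∈ Subgroup.zpowers a
  · exact Or.inl hh
  · exact Or.inr (hmulA _ _ (fun h' => hg (inv_mem_iff.1 h')) hh)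

end TwoGroups

/-! ### Element orders in groups with chordal graph -/

section Orders

variable {G : Type*} [Group G]

theorem orderOf_le_three_of_isChordal (hc : IsChordal (primeOrderGraph G)) {x : G}
    (hx : (orderOf x).Prime) : orderOf x = 2 ∨ orderOf x = 3 := by
  by_contra hn
  push Not at hn
  have h2 := hx.two_le
  have key : ∀ k : ℕ, k ≠ 0 → k < 5 → x ^ k ≠ 1 := by
    intro k hk hk5 e
    have hd := orderOf_dvd_of_pow_eq_one e
    have := Nat.le_of_dvd (by omega) hd
    have h4 : orderOf x = 4 := by omega
    rw [h4] at hx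
    exact absurd hx (by norm_num)
  have hpow : ∀ k : ℕ, k ≠ 0 → k < 5 → (orderOf (x ^ k)).Prime := by
    intro k hk hk5
    have : Fact (orderOf x).Prime := ⟨hx⟩
    rwa [orderOf_eq_prime (p := orderOf x) _ (key k hk hk5)]
    rw [← pow_mul, mul_comm, pow_mul, pow_orderOf_eq_one, one_pow]
  refine not_isChordal_of_mul_of_mul_inv (g := x ^ 2) (h := x) ?_ ?_ ?_ ?_ hc
  · rw [← pow_add]; exact key 4 (by omega) (by omega)
  · rw [← pow_two]; exact key 2 (by omega) (by omega)
  · rw [← pow_succ]; exact hpow 3 (by omega) (by omega)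
  · rw [pow_two, mul_inv_cancel_right]
    simpa using hpow 1 (by omega) (by omega)

/-- An element of order six gives the induced `4`-cycle `x, x ^ 2, 1, x ^ 3`. -/
theorem orderOf_ne_six_of_isChordal (hc : IsChordal (primeOrderGraph G)) (x : G) :
    orderOf x ≠ 6 := by
  intro hx
  have hp : ∀ k : ℕ, k ≠ 0 → orderOf (x ^ k) = 6 / Nat.gcd 6 k := fun k hk => by
    rw [orderOf_pow' x hk, hx]
  have hne : ∀ k : ℕ, k ≠ 0 → k < 6 → x ^ k ≠ 1 := fun k hk h6 =>
    pow_ne_one_of_lt_orderOf hk (by omega)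
  refine not_isChordal_of_square (a := x) (b := x ^ 2) (c := 1) (d := x ^ 3)
    ?_ ?_ ?_ ?_ ?_ ?_ ?_ ?_ hc
  · simpa using hne 1 (by omega) (by omega)
  · intro e
    rw [pow_succ x 2] at e
    exact hne 1 (by omega) (by omega) (by simpa using e)
  · rw [← pow_succ', hp _ (by omega)]; norm_num
  · rw [mul_one, hp _ (by omega)]; norm_num
  · rw [one_mul, hp _ (by omega)]; norm_num
  · rw [← pow_succ, hp _ (by omega)]; norm_num
  · rw [mul_one, hx]; norm_num
  · rw [← pow_add, hp _ (by omega)]; norm_num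

/-- An element of order nine gives an induced `6`-cycle formed by the generators of `⟨x⟩`. -/
theorem orderOf_ne_nine_of_isChordal (hc : IsChordal (primeOrderGraph G)) (x : G) :
    orderOf x ≠ 9 := by
  intro hx
  let e : Fin 6 → ℕ := ![1, 2, 4, 8, 7, 5]
  have he : ∀ i j, x ^ e i = x ^ e j ↔ i = j := by
    intro i j
    rw [pow_eq_pow_iff_modEq, hx]
    revert i j
    decide
  refine (hc 6 (by norm_num)).false
    { toFun := fun i => x ^ e i
      inj' := fun i j h => (he i j).1 h
      map_rel_iff' := ?_ }
  intro i j
  change (x ^ e i ≠ x ^ e j ∧ (orderOf (x ^ e i * x ^ e j)).Prime) ↔ _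
  have h0 : e i + e j ≠ 0 := by revert i j; decide
  rw [Ne, he, ← pow_add, orderOf_pow' x h0, hx]
  revert i j
  decide

theorem two_or_three_of_prime_dvd_card [Finite G] (hc : IsChordal (primeOrderGraph G)) {p : ℕ}
    (hp : p.Prime) (hd : p ∣ Nat.card G) : p = 2 ∨ p = 3 := by
  have : Fact p.Prime := ⟨hp⟩
  obtain ⟨x, rfl⟩ := exists_prime_orderOf_dvd_card' p hd
  exact orderOf_le_three_of_isChordal hc hp

/-- A subgroup of order nine contains elements `x`, `y` with `y ∉ ⟨x⟩`, and all its nontrivial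
elements have order three, in particular `x * y` and `x * y⁻¹`. -/
theorem not_nine_dvd_card_of_isChordal [Finite G] (hc : IsChordal (primeOrderGraph G)) :
    ¬ 9 ∣ Nat.card G := by
  intro hd
  have : Fact (Nat.Prime 3) := ⟨Nat.prime_three⟩
  obtain ⟨K, hK⟩ := Sylow.exists_subgroup_card_pow_prime (G := G) 3 (n := 2) hd
  have h3 : ∀ x ∈ K, x ≠ 1 → orderOf x = 3 := by
    intro x hx hx1
    have h : orderOf x ∣ 3 ^ 2 := by
      rw [← hK]
      exact K.orderOf_dvd_natCard hx
    obtain ⟨k, hk, hk'⟩ := (Nat.dvd_prime_pow Nat.prime_three).1 h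
    interval_cases k
    · exact absurd (orderOf_eq_one_iff.1 hk') hx1
    · exact hk'
    · exact absurd hk' (orderOf_ne_nine_of_isChordal hc x)
  have hsq : ∀ x ∈ K, x ≠ 1 → x * x ≠ 1 := by
    intro x hx hx1 e
    have h := h3 x hx hx1
    rw [orderOf_eq_two_of_mul_self e hx1] at h
    omega
  have hp : ∀ x ∈ K, x ≠ 1 → (orderOf x).Prime := fun x hx hx1 => by
    rw [h3 x hx hx1]; exact Nat.prime_three
  obtain ⟨x, hx, hx1⟩ := K.bot_or_exists_ne_one.resolve_left (by
    rintro rfl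
    simp at hK)
  obtain ⟨y, hy, hyx⟩ : ∃ y ∈ K, y ∉ Subgroup.zpowers x := by
    by_contra! hn
    have h := Subgroup.card_le_of_le (show K ≤ Subgroup.zpowers x from hn)
    rw [hK, Nat.card_zpowers, h3 x hx hx1] at h
    omega
  refine not_isChordal_of_mul_of_mul_inv (hsq x hx hx1) (hsq y hy ?_)
    (hp _ (K.mul_mem hx hy) ?_) (hp _ (K.mul_mem hx (K.inv_mem hy)) ?_) hc
  · rintro rfl; exact hyx (one_mem _)
  · intro e
    rw [← inv_eq_of_mul_eq_one_right e] at hyx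
    exact hyx (inv_mem (Subgroup.mem_zpowers x))
  · intro e
    rw [← mul_inv_eq_one.1 e] at hyx
    exact hyx (Subgroup.mem_zpowers x)

/-! ### `2`-groups with chordal graph -/

/-- Let `h` have order four, let `z` be a central involution and `v` another involution. If
`h * h ≠ z` or `(v * h) * (v * h) ≠ 1`, there is an induced `4`-cycle of inverse pairs. Otherwise
`h` and `v` generate a dihedral group of order eight, with the induced `4`-cycle
`h, v, h⁻¹, v * h`. -/
theorem forall_mul_self_eq_one_or_involution_unique [Finite G] (hP : IsPGroup 2 G)
    (hc : IsChordal (primeOrderGraph G)) :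
    (∀ x : G, x * x = 1) ∨ ∀ x y : G, orderOf x = 2 → orderOf y = 2 → x = y := by
  have : Fact (Nat.Prime 2) := ⟨Nat.prime_two⟩
  by_contra! hn
  obtain ⟨⟨x, hx⟩, u, u', hu, hu', huu⟩ := hn
  obtain ⟨h, hh4⟩ : ∃ h : G, orderOf h = 4 := by
    obtain ⟨k, hk⟩ := IsPGroup.iff_orderOf.1 hP x
    refine ⟨x ^ (orderOf x / 4), orderOf_pow_orderOf_div (orderOf_pos x).ne' ?_⟩
    rw [hk]
    refine pow_dvd_pow 2 (n := k) (m := 2) ?_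
    by_contra hk2
    apply hx
    rw [← pow_two, ← orderOf_dvd_iff_pow_eq_one, hk]
    exact (pow_dvd_pow 2 (show k ≤ 1 by omega)).trans (by simp)
  have : Nontrivial G := ⟨⟨u, u', huu⟩⟩
  obtain ⟨z, -, hzc, hz2⟩ := hP.exists_mem_center_orderOf_eq ⊤ bot_lt_top.ne'
  have hz : z * z = 1 := mul_self_eq_one_of_orderOf hz2
  have hz1 : z ≠ 1 := by rintro rfl; simp at hz2
  have hcomm : ∀ g, g * z = z * g := Subgroup.mem_center_iff.1 hzc
  have hsq : ∀ g, g * z * (g * z) = g * g := fun g => by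
    rw [mul_assoc, ← mul_assoc z, ← hcomm, mul_assoc, hz, mul_one]
  obtain ⟨v, hv2, hvz⟩ : ∃ v : G, orderOf v = 2 ∧ v ≠ z := by
    by_cases e : u = z
    · exact ⟨u', hu', fun e' => huu (e.trans e'.symm)⟩
    · exact ⟨u, hu, e⟩
  have hv : v * v = 1 := mul_self_eq_one_of_orderOf hv2
  have hv1 : v ≠ 1 := by rintro rfl; simp at hv2
  have hh1 : h * h ≠ 1 := by
    rw [← pow_two]
    exact pow_ne_one_of_lt_orderOf (by omega) (by omega)
  have hh : h * h * (h * h) = 1 := by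
    rw [← pow_two, ← pow_two, ← pow_mul, ← orderOf_dvd_iff_pow_eq_one, hh4]
  have hp : ∀ {x : G}, x * x = 1 → x ≠ 1 → (orderOf x).Prime := prime_orderOf_of_mul_self
  by_cases hhz : h * h = z
  · have hvzs : v * z * (v * z) = 1 := (hsq v).trans hv
    have hvz1 : v * z ≠ 1 := fun e => hvz (mul_right_cancel (e.trans hz.symm))
    by_cases hvh : v * h * (v * h) = 1
    · have hhv : h * v * h = v := by
        have e : v * (h * v * h) = v * v := by rw [hv, ← hvh]; group
        exact mul_left_cancel e
      have hhv' : h⁻¹ * v * h⁻¹ = v := by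
        nth_rewrite 1 [← hhv]
        group
      have hne : h ≠ v := by rintro rfl; exact hh1 hv
      refine not_isChordal_of_square (a := h) (b := v) (c := h⁻¹) (d := v * h)
        ?_ ?_ (hp ?_ ?_) (hp ?_ ?_) ?_ (hp ?_ ?_) ?_ ?_ hc
      · exact fun e => hh1 (mul_eq_one_iff_eq_inv.2 e)
      · intro e
        rw [left_eq_mul] at e
        simp [e] at hh1
      · rw [← mul_assoc, hhv, hv]
      · intro e
        exact hne (mul_right_cancel (e.trans hv.symm))
      · rw [mul_assoc, ← mul_assoc h⁻¹, hhv', hv]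
      · exact fun e => hne (mul_inv_eq_one.1 e).symm
      · rw [orderOf_mul_comm, mul_inv_cancel_right, hv2]
        exact Nat.prime_two
      · rwa [mul_assoc v, hhz]
      · rwa [mul_assoc v, hhz]
      · simp [Nat.not_prime_one]
      · rw [← mul_assoc, hv, one_mul, hh4]
        norm_num
    · refine not_isChordal_of_mul_of_mul_inv (g := v * h) (h := h) hvh hh1 (hp ?_ ?_) (hp ?_ ?_) hc
      · rwa [mul_assoc v, hhz]
      · rwa [mul_assoc v, hhz]
      · rwa [mul_inv_cancel_right]
      · rwa [mul_inv_cancel_right]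
  · have e : h * (h * z) * (h * (h * z)) = 1 := by
      rw [← mul_assoc h h z, hsq, hh]
    refine not_isChordal_of_mul_of_mul_inv (g := h) (h := h * z) hh1 (by rwa [hsq])
      (hp e ?_) (hp ?_ ?_) hc
    · intro e'
      rw [← mul_assoc] at e'
      exact hhz (mul_right_cancel (e'.trans hz.symm))
    all_goals
      rw [mul_inv_rev, inv_eq_of_mul_eq_one_right hz, ← hcomm, mul_inv_cancel_left]
      assumption

end Orders

/-! ### Groups with chordal graph -/

section Classification

variable {G : Type*} [Group G]

theorem mul_comm_of_forall_mul_self_eq_one (h : ∀ x : G, x * x = 1) (x y : G) :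
    x * y = y * x := by
  have hinv : ∀ x : G, x⁻¹ = x := fun x => inv_eq_of_mul_eq_one_right (h x)
  rw [← hinv (x * y), mul_inv_rev, hinv, hinv]

theorem exists_mulEquiv_pi_zmod_two [Finite G] (h : ∀ x : G, x * x = 1) :
    ∃ n : ℕ, Nonempty (G ≃* Multiplicative (Fin n → ZMod 2)) := by
  let _ : CommGroup G := { (inferInstance : Group G) with
    mul_comm := mul_comm_of_forall_mul_self_eq_one h }
  let _ : Module (ZMod 2) (Additive G) := AddCommGroup.zmodModule (n := 2) fun x => by
    rw [two_nsmul]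
    exact h x.toMul
  let e := (Module.finBasis (ZMod 2) (Additive G)).equivFun.toAddEquiv
  exact ⟨_, ⟨e.toMultiplicativeRight⟩⟩

theorem orderOf_mul_eq_six_of_commute {w x : G} (h : Commute w x) (hw : orderOf w = 2)
    (hx : orderOf x = 3) : orderOf (w * x) = 6 := by
  rw [h.orderOf_mul_eq_mul_orderOf_of_coprime (by rw [hw, hx]; norm_num), hw, hx]

/-- The action on the three cosets of `S` is faithful: a nontrivial kernel would be a `2`-group
whose only involution is central in `G`, and would give an element of order six. -/
theorem mulEquiv_of_index_eq_three [Finite G] (h6 : ∀ x : G, orderOf x ≠ 6) (S : Subgroup G)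
    (hS : IsPGroup 2 S) (hi : S.index = 3)
    (hu : ∀ x ∈ S, ∀ y ∈ S, orderOf x = 2 → orderOf y = 2 → x = y) :
    Nonempty (G ≃* Equiv.Perm (Fin 3)) ∨ Nonempty (G ≃* Multiplicative (ZMod 3)) := by
  have : Fact (Nat.Prime 2) := ⟨Nat.prime_two⟩
  have : Fact (Nat.Prime 3) := ⟨Nat.prime_three⟩
  have h3 : 3 ∣ Nat.card G := hi ▸ S.index_dvd_card
  have hcore : S.normalCore = ⊥ := by
    by_contra hne
    obtain ⟨w, hw⟩ := exists_prime_orderOf_dvd_card' (G := S.normalCore) 2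
      (((hS.to_le S.normalCore_le).card_eq_or_dvd).resolve_left
        fun h => hne (Subgroup.card_eq_one.1 h))
    obtain ⟨x, hx⟩ := exists_prime_orderOf_dvd_card' 3 h3
    have hw' : orderOf (w : G) = 2 := by rwa [Subgroup.orderOf_coe]
    have hconj : x * w * x⁻¹ = w := by
      refine hu _ (S.normalCore_le (S.normalCore_normal.conj_mem _ w.2 x)) _
        (S.normalCore_le w.2) ?_ hw'
      rw [orderOf_mul_comm, inv_mul_cancel_left, hw']
    exact h6 _ (orderOf_mul_eq_six_of_commute (mul_inv_eq_iff_eq_mul.1 hconj).symm hw' hx)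
  have hcard : Nat.card (G ⧸ S) = 3 := hi
  let e : G ⧸ S ≃ Fin 3 := Finite.equivFinOfCardEq hcard
  let f : G →* Equiv.Perm (Fin 3) :=
    e.permCongrHom.toMonoidHom.comp (MulAction.toPermHom G (G ⧸ S))
  have hf : Function.Injective f := by
    refine e.permCongrHom.injective.comp ?_
    rw [← MonoidHom.ker_eq_bot_iff, ← Subgroup.normalCore_eq_ker, hcore]
  have h6' : Nat.card (Equiv.Perm (Fin 3)) = 6 := by
    rw [Nat.card_perm, Nat.card_fin]
    rfl
  obtain ⟨k, hk⟩ := h3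
  have hd : 3 * k ∣ 3 * 2 := by
    rw [← hk]
    exact (Subgroup.card_dvd_of_injective f hf).trans h6'.dvd
  rcases (Nat.dvd_prime Nat.prime_two).1 (Nat.dvd_of_mul_dvd_mul_left (by norm_num) hd) with
    rfl | rfl
  · exact Or.inr ⟨mulEquivOfPrimeCardEq (p := 3) hk (by simp)⟩
  · exact Or.inl ⟨MulEquiv.ofBijective f (hf.bijective_of_nat_card_le (by rw [hk, h6']))⟩

theorem prime_orderOf_of_orderOf_ne_four [Finite G] (hc : IsChordal (primeOrderGraph G))
    (h4 : ∀ x : G, orderOf x ≠ 4) {u : G} (hu : u ≠ 1) : (orderOf u).Prime := by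
  by_contra hn
  have hu1 : orderOf u ≠ 1 := fun h => hu (orderOf_eq_one_iff.1 h)
  obtain ⟨p, hp, m, hm⟩ := Nat.exists_prime_and_dvd hu1
  have hm1 : m ≠ 1 := by
    rintro rfl
    rw [hm, mul_one] at hn
    exact hn hp
  obtain ⟨q, hq, l, rfl⟩ := Nat.exists_prime_and_dvd hm1
  have hpq : p * q ∣ orderOf u := ⟨l, by rw [hm, mul_assoc]⟩
  have hord := orderOf_pow_orderOf_div (orderOf_pos u).ne' hpq
  have hcard : p * q ∣ Nat.card G := hpq.trans (orderOf_dvd_natCard u)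
  rcases two_or_three_of_prime_dvd_card hc hp ((dvd_mul_right _ _).trans hcard) with rfl | rfl <;>
    rcases two_or_three_of_prime_dvd_card hc hq ((dvd_mul_left _ _).trans hcard) with rfl | rfl
  · exact h4 _ hord
  · exact orderOf_ne_six_of_isChordal hc _ hord
  · exact orderOf_ne_six_of_isChordal hc _ hord
  · exact orderOf_ne_nine_of_isChordal hc _ hord

/-- If all nontrivial elements have prime order, an element `x` of order three and its inverse are
the only elements which do not square to `1`. So every involution inverts `x`, and the product of
two commuting involutions centralises it. -/
theorem eq_of_commute_of_orderOf_eq_two (hc : IsChordal (primeOrderGraph G))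
    (hp : ∀ u : G, u ≠ 1 → (orderOf u).Prime) {x s t : G} (hx : orderOf x = 3)
    (hs : orderOf s = 2) (ht : orderOf t = 2) (hst : Commute s t) : s = t := by
  by_contra hne
  have hx2 : x * x ≠ 1 := by
    rw [← pow_two]
    exact pow_ne_one_of_lt_orderOf (by omega) (by omega)
  have hor : ∀ y : G, y * y ≠ 1 → y = x ∨ y = x⁻¹ := by
    intro y hy
    by_contra! hn
    refine not_isChordal_of_mul_of_mul_inv hx2 hy (hp _ ?_) (hp _ ?_) hc
    · exact fun e => hn.2 (inv_eq_of_mul_eq_one_right e).symm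
    · exact fun e => hn.1 (mul_inv_eq_one.1 e).symm
  have hinv : ∀ u : G, orderOf u = 2 → u * x * u⁻¹ = x⁻¹ := by
    intro u hu
    refine (hor (u * x * u⁻¹) ?_).resolve_left ?_
    · rwa [conj_mul, Ne, conj_eq_one_iff]
    · intro e
      exact orderOf_ne_six_of_isChordal hc _
        (orderOf_mul_eq_six_of_commute (mul_inv_eq_iff_eq_mul.1 e) hu hx)
  have hs1 := mul_self_eq_one_of_orderOf hs
  have ht1 := mul_self_eq_one_of_orderOf ht
  have hst2 : orderOf (s * t) = 2 := by
    refine orderOf_eq_two_of_mul_self ?_ fun e => hne (mul_right_cancel (e.trans ht1.symm))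
    rw [mul_assoc, ← mul_assoc t, ← hst.eq, mul_assoc, ht1, mul_one, hs1]
  have h := hinv _ hst2
  rw [show s * t * x * (s * t)⁻¹ = s * (t * x * t⁻¹) * s⁻¹ by group, hinv t ht, ← conj_inv,
    hinv s hs, inv_inv] at h
  exact hx2 (mul_eq_one_iff_eq_inv.2 h)

theorem index_sylow_two_eq_three [Finite G] (hc : IsChordal (primeOrderGraph G))
    (h3 : 3 ∣ Nat.card G) (S : Sylow 2 G) : (S : Subgroup G).index = 3 := by
  have : Fact (Nat.Prime 2) := ⟨Nat.prime_two⟩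
  have hmul := (S : Subgroup G).card_mul_index
  obtain ⟨n, hn⟩ := IsPGroup.iff_card.1 S.isPGroup'
  have h3i : 3 ∣ (S : Subgroup G).index := by
    rw [← hmul] at h3
    refine (Nat.prime_three.dvd_mul.1 h3).resolve_left fun h => ?_
    rw [hn] at h
    have := Nat.prime_three.dvd_of_dvd_pow h
    omega
  obtain ⟨m, hm⟩ := h3i
  have hm1 : m = 1 := by
    by_contra hm1
    obtain ⟨q, hq, hqm⟩ := Nat.exists_prime_and_dvd hm1
    have hqi : 3 * q ∣ (S : Subgroup G).index := hm ▸ mul_dvd_mul_left 3 hqm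
    have hqG := hqi.trans (Subgroup.index_dvd_card _)
    rcases two_or_three_of_prime_dvd_card hc hq ((dvd_mul_left _ _).trans hqG) with rfl | rfl
    · exact S.not_dvd_index ((dvd_mul_left _ _).trans hqi)
    · exact not_nine_dvd_card_of_isChordal hc hqG
  rw [hm, hm1]

theorem mulEquiv_of_three_dvd_card [Finite G] (hc : IsChordal (primeOrderGraph G))
    (h3 : 3 ∣ Nat.card G) :
    Nonempty (G ≃* Equiv.Perm (Fin 3)) ∨ Nonempty (G ≃* Multiplicative (ZMod 3)) := by
  have : Fact (Nat.Prime 2) := ⟨Nat.prime_two⟩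
  have : Fact (Nat.Prime 3) := ⟨Nat.prime_three⟩
  let S : Sylow 2 G := default
  refine mulEquiv_of_index_eq_three (orderOf_ne_six_of_isChordal hc) S S.isPGroup'
    (index_sylow_two_eq_three hc h3 S) ?_
  intro s hs t ht hs2 ht2
  rcases forall_mul_self_eq_one_or_involution_unique S.isPGroup'
    (hc.of_injective_hom (Subgroup.subtype _) (Subgroup.subtype_injective _)) with h | h
  · have h4 : ∀ y : G, orderOf y ≠ 4 := by
      intro y hy
      have hY : IsPGroup 2 (Subgroup.zpowers y) :=
        IsPGroup.of_card (n := 2) (by rw [Nat.card_zpowers, hy]; norm_num)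
      obtain ⟨Q, hQ⟩ := hY.exists_le_sylow
      let y' : Q := ⟨y, hQ (Subgroup.mem_zpowers y)⟩
      have hyy : y' * y' = 1 := (Sylow.equiv Q S).injective (by rw [map_mul, h, map_one])
      refine pow_ne_one_of_lt_orderOf (x := y) (n := 2) (by omega) (by omega) ?_
      rw [pow_two]
      exact congrArg Subtype.val hyy
    obtain ⟨x, hx⟩ := exists_prime_orderOf_dvd_card' 3 h3
    refine eq_of_commute_of_orderOf_eq_two hc
      (fun u hu => prime_orderOf_of_orderOf_ne_four hc h4 hu) hx hs2 ht2 ?_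
    exact congrArg Subtype.val (mul_comm_of_forall_mul_self_eq_one h ⟨s, hs⟩ ⟨t, ht⟩)
  · have e := h ⟨s, hs⟩ ⟨t, ht⟩ (by rwa [Subgroup.orderOf_mk]) (by rwa [Subgroup.orderOf_mk])
    exact congrArg Subtype.val e

theorem isPGroup_two_of_isChordal [Finite G] (hc : IsChordal (primeOrderGraph G))
    (h3 : ¬ 3 ∣ Nat.card G) : IsPGroup 2 G := by
  refine IsPGroup.of_card (n := (Nat.card G).primeFactorsList.length) ?_
  refine Nat.eq_prime_pow_of_unique_prime_dvd Nat.card_pos.ne' fun {d} hd hdvd => ?_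
  refine (two_or_three_of_prime_dvd_card hc hd hdvd).resolve_right ?_
  rintro rfl
  exact h3 hdvd

end Classification

theorem mainTheorem1 (G : Type*) [Group G] [Finite G] :
    IsChordal (primeOrderGraph G) ↔
      Nonempty (G ≃* Equiv.Perm (Fin 3)) ∨
      Nonempty (G ≃* Multiplicative (ZMod 3)) ∨
      (∃ n : ℕ, Nonempty (G ≃* Multiplicative (ZMod (2 ^ n)))) ∨
      (∃ n : ℕ, 3 ≤ n ∧ Nonempty (G ≃* QuaternionGroup (2 ^ (n - 2)))) ∨
      (∃ n : ℕ, Nonempty (G ≃* Multiplicative (Fin n → ZMod 2))) := by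
  constructor
  · intro hc
    have : Fact (Nat.Prime 2) := ⟨Nat.prime_two⟩
    by_cases h3 : 3 ∣ Nat.card G
    · rcases mulEquiv_of_three_dvd_card hc h3 with h | h
      · exact Or.inl h
      · exact Or.inr (Or.inl h)
    · have hP := isPGroup_two_of_isChordal hc h3
      rcases forall_mul_self_eq_one_or_involution_unique hP hc with h | h
      · exact Or.inr (Or.inr (Or.inr (Or.inr (exists_mulEquiv_pi_zmod_two h))))
      · rcases isCyclic_or_quaternionGroup hP h with hcyc | ⟨m, hm, he⟩
        · obtain ⟨n, hn⟩ := IsPGroup.iff_card.1 hP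
          exact Or.inr (Or.inr (Or.inl ⟨n, ⟨mulEquivOfCyclicCardEq (by rw [hn]; simp)⟩⟩))
        · exact Or.inr (Or.inr (Or.inr (Or.inl ⟨m + 2, by omega, by rwa [Nat.add_sub_cancel]⟩)))
  · rintro (⟨⟨e⟩⟩ | ⟨⟨e⟩⟩ | ⟨n, ⟨e⟩⟩ | ⟨n, -, ⟨e⟩⟩ | ⟨n, ⟨e⟩⟩)
    · exact isChordal_perm_fin_three.of_injective_hom e.toMonoidHom e.injective
    · exact isChordal_zmod_three.of_injective_hom e.toMonoidHom e.injective
    · exact (isChordal_zmod_two_pow n).of_injective_hom e.toMonoidHom e.injective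
    · exact (isChordal_quaternionGroup _).of_injective_hom e.toMonoidHom e.injective
    · exact (isChordal_pi_zmod_two n).of_injective_hom e.toMonoidHom e.injective
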